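/- Let $R$ be a ring (associative with $1$), not necessarily commutative; modules are right $R$-modules. For a module $T$, let $\operatorname{Add}T$ be the class of all modules isomorphic to direct summands of direct sums of copies of $T$, let $T^{\perp}=\{M : \operatorname{Ext}^i_R(T,M)=0 \text{ for all } i>0\}$, and let $\mathcal X_{T}=\{M\in T^\perp : \operatorname{Hom}_R(T,M)=0\}$. A module $T$ is a *tilting module* (of projective dimension at most one) if $\operatorname{pd}T\le 1$, $\operatorname{Ext}^1_R(T,T^{(I)})=0$ for every set $I$, and there is an exact sequence $0\to R\to T_0\to T_1\to 0$ with $T_0,T_1\in\operatorname{Add}T$. Two tilting modules $T,T'$ are *equivalent* if $T^\perp=T'^\perp$. A full subcategory of $\operatorname{Mod}R$ is a *Giraud subcategory* if its inclusion into $\operatorname{Mod}R$ has an exact left adjoint. A *Gabriel topology* on $R$ is a non-empty set $\mathcal G$ of right ideals such that: (a) every right ideal containing a member of $\mathcal G$ is in $\mathcal G$; (b) $I,K\in\mathcal G$ implies $I\cap K\in\mathcal G$; (c) if $I\in\mathcal G$ and $x\in R$ then $(I:x)=\{r\in R : xr\in I\}\in\mathcal G$; (d) if $K$ is a right ideal and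 there is $I\in\mathcal G$ with $(K:x)\in\mathcal G$ for all $x\in I$, then $K\in\mathcal G$. A module $C$ is *$\mathcal G$-closed* if for every $I\in\mathcal G$ the restriction map $\operatorname{Hom}_R(R,C)\to\operatorname{Hom}_R(I,C)$ is bijective. The inclusion of the full subcategory of $\mathcal G$-closed modules into $\operatorname{Mod}R$ has a left adjoint; the reflection $R\to Q_{\mathcal G}$ of the module $R$ induces a ring structure on $Q_{\mathcal G}$ for which it is a ring homomorphism $\lambda_{\mathcal G}:R\to Q_{\mathcal G}$. The topology $\mathcal G$ is *perfect* if the $\mathcal G$-closed modules are exactly the modules in the essential image of the restriction functor $\operatorname{Mod}Q_{\mathcal G}\to\operatorname{Mod}R$ along $\lambda_{\mathcal G}$. **Theorem.** Let $T$ be a tilting right $R$-module (of projective dimension at most one). The following are equivalent: 1. There is an exact sequence $0\to R\to T_0\to T_1\to 0$ of right $R$-modules such that $T_0,T_1\in\operatorname{Add}T$, $\operatorname{Hom}_R(T_1,T_0)=0$, and $\mathcal X_{T_1}$ is a Giraud subcategory of $\operatorname{Mod}R$. 2. $T$ arises from perfect localization: there is a perfect Gabriel topology $\mathcal G$ on $R$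 such that $\lambda_{\mathcal G}:R\to Q_{\mathcal G}$ is injective and $Q_{\mathcal G}\oplus Q_{\mathcal G}/R$ is a tilting right $R$-module equivalent to $T$. -/

import Mathlib

open CategoryTheory Limits MulOpposite

universe u

/-- The category of right `R`-modules: a right `R`-module is a (left) module over the opposite
ring, with `x r` written `op r • x`. In particular `Submodule Rᵐᵒᵖ R` is the lattice of right
ideals of `R`. -/
abbrev RightMod (R : Type u) [Ring R] := ModuleCat.{u} Rᵐᵒᵖ

namespace RightMod

variable {R : Type u} [Ring R]

/-- `M` belongs to `Add T`: it is isomorphic to a direct summand of a direct sum of copies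
of `T`. -/
def Add (T : RightMod R) : ObjectProperty (RightMod R) := fun M =>
  ∃ (I : Type u) (N : RightMod R), Nonempty ((M × N) ≃ₗ[Rᵐᵒᵖ] (I →₀ T))

/-- The class `T^⊥` of all right modules `M` with `Ext^i(T, M) = 0` for all `i > 0`. -/
def extPerp (T : RightMod R) : ObjectProperty (RightMod R) := fun M =>
  ∀ i : ℕ, 0 < i → Subsingleton (Abelian.Ext.{u} T M i)

/-- The perpendicular category of `T`: all right modules `M` with `Hom(T, M) = 0` and
`Ext^i(T, M) = 0` for all `i > 0`. -/
def perpCat (T : RightMod R) : ObjectProperty (RightMod R) := fun M =>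
  (∀ f : T →ₗ[Rᵐᵒᵖ] M, f = 0) ∧ extPerp T M

/-- Short exact sequences `0 → R → T₀ → T₁ → 0` of right modules with `T₀, T₁ ∈ Add T`. -/
structure AddCoresolution (T T₀ T₁ : RightMod R) where
  /-- the map `R → T₀` -/
  f : R →ₗ[Rᵐᵒᵖ] T₀
  /-- the map `T₀ → T₁` -/
  g : T₀ →ₗ[Rᵐᵒᵖ] T₁
  injective : Function.Injective f
  exact : Function.Exact f g
  surjective : Function.Surjective g
  mem_add₀ : Add T T₀
  mem_add₁ : Add T T₁

/-- Tilting right modules (of projective dimension at most one). -/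
structure IsTilting (T : RightMod R) : Prop where
  projDim_le_one : HasProjectiveDimensionLE T 1
  ext_directSum : ∀ I : Type u,
    Subsingleton (Abelian.Ext.{u} T (ModuleCat.of Rᵐᵒᵖ (I →₀ T)) 1)
  coresolution : ∃ T₀ T₁ : RightMod R, Nonempty (AddCoresolution T T₀ T₁)

/-- Two tilting modules are equivalent if their tilting classes coincide. -/
def TiltingEquivalent (T T' : RightMod R) : Prop := extPerp T = extPerp T'

/-- A full subcategory of the category of right modules is a Giraud subcategory if its
inclusion functor has an exact left adjoint, that is, a left adjoint that preserves finite
limits and finite colimits. -/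
def IsGiraud (P : ObjectProperty (RightMod R)) : Prop :=
  ∃ l : RightMod R ⥤ P.FullSubcategory,
    Nonempty (l ⊣ P.ι) ∧ PreservesFiniteLimits l ∧ PreservesFiniteColimits l

end RightMod

/-- For a right ideal `I` and `x ∈ R`, the right ideal `(I : x) = {r ∈ R | x r ∈ I}`. -/
def rightColon {R : Type u} [Ring R] (I : Submodule Rᵐᵒᵖ R) (x : R) : Submodule Rᵐᵒᵖ R :=
  I.comap (LinearMap.mulLeft Rᵐᵒᵖ x)

/-- Gabriel topologies on `R`, as sets of right ideals. -/
structure GabrielTopology (R : Type u) [Ring R] where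
  /-- the right ideals belonging to the topology -/
  ideals : Set (Submodule Rᵐᵒᵖ R)
  nonempty : ideals.Nonempty
  mem_of_le : ∀ I ∈ ideals, ∀ K : Submodule Rᵐᵒᵖ R, I ≤ K → K ∈ ideals
  inf_mem : ∀ I ∈ ideals, ∀ K ∈ ideals, I ⊓ K ∈ ideals
  colon_mem : ∀ I ∈ ideals, ∀ x : R, rightColon I x ∈ ideals
  mem_of_colon_mem : ∀ K : Submodule Rᵐᵒᵖ R,
    (∃ I ∈ ideals, ∀ x ∈ I, rightColon K x ∈ ideals) → K ∈ ideals

/-- The category of modules over a ring is locally presentable. -/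
theorem moduleCat_isLocallyPresentable (A : Type u) [Ring A] :
    IsLocallyPresentable.{u} (ModuleCat.{u} A) := by
  have : Fact (Cardinal.aleph0.{u}).IsRegular := Cardinal.fact_isRegular_aleph0
  refine ⟨Cardinal.aleph0, this, ?_⟩
  rw [IsCardinalLocallyPresentable.iff_exists_isStrongGenerator]
  refine ⟨.singleton (ModuleCat.of A A), inferInstance, ?_, ?_⟩
  · rw [ObjectProperty.isStrongGenerator_iff]
    refine ⟨fun X Y f g h => ?_, fun X Y i _ h => ?_⟩
    · ext x
      have := h (ModuleCat.of A A) (by simp) (ModuleCat.ofHom (LinearMap.toSpanSingleton A X x))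
      simpa using congr($(this).hom (1 : A))
    · have h := h (ModuleCat.of A A) (by simp)
      have : Epi i := by
        rw [ModuleCat.epi_iff_surjective]
        intro y
        obtain ⟨f, hf⟩ := h (ModuleCat.ofHom (LinearMap.toSpanSingleton A Y y))
        refine ⟨f.hom (1 : A), ?_⟩
        simpa using congr($(hf).hom (1 : A))
      exact isIso_of_mono_of_epi i
  · intro X hX
    obtain rfl : ModuleCat.of A A = X := by simpa using hX
    change IsFinitelyPresentable _
    rw [isFinitelyPresentable_iff_preservesFilteredColimits]
    let e : forget (ModuleCat.{u} A) ≅ coyoneda.obj (Opposite.op (ModuleCat.of A A)) :=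
      NatIso.ofComponents (fun M => Equiv.toIso
        { toFun := fun x => ModuleCat.ofHom (LinearMap.toSpanSingleton A M x)
          invFun := fun f => f.hom (1 : A)
          left_inv := fun x => by simp
          right_inv := fun f => ModuleCat.hom_ext (LinearMap.ext_ring (by simp)) })
        (fun f => by
          ext x
          exact ModuleCat.hom_ext (LinearMap.ext_ring (by simp)))
    exact ⟨fun J _ _ => preservesColimitsOfShape_of_natIso e⟩

namespace GabrielTopology

variable {R : Type u} [Ring R] (G : GabrielTopology R)

/-- The `G`-closed right modules: those `C` for which restriction
`Hom(R, C) → Hom(I, C)` is bijective for every `I ∈ G`. -/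
def closed : ObjectProperty (RightMod R) := fun C =>
  ∀ I ∈ G.ideals, Function.Bijective
    (fun f : R →ₗ[Rᵐᵒᵖ] C => (f.comp I.subtype : I →ₗ[Rᵐᵒᵖ] C))

/-- The inclusion of the `G`-closed modules has a left adjoint. -/
instance isRightAdjoint_closed_ι : G.closed.ι.IsRightAdjoint := by
  have := moduleCat_isLocallyPresentable Rᵐᵒᵖ
  let W : MorphismProperty (RightMod R) :=
    .ofHoms (fun I : G.ideals => ModuleCat.ofHom I.1.subtype)
  have hW : G.closed = W.isLocal := by
    ext C
    constructor
    · rintro hC X Y f ⟨I⟩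
      have := hC I.1 I.2
      refine ⟨fun a b h => ?_, fun a => ?_⟩
      · exact ModuleCat.hom_ext (this.1 congr(($h).hom))
      · obtain ⟨b, hb⟩ := this.2 a.hom
        exact ⟨ModuleCat.ofHom b, ModuleCat.hom_ext hb⟩
    · intro hC I hI
      have := hC _ (MorphismProperty.ofHoms.mk (f := fun I : G.ideals =>
        ModuleCat.ofHom I.1.subtype) ⟨I, hI⟩)
      refine ⟨fun a b h => ?_, fun a => ?_⟩
      · exact congr($(this.1 (a₁ := ModuleCat.ofHom a) (a₂ := ModuleCat.ofHom b)
          (ModuleCat.hom_ext h)).hom)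
      · obtain ⟨b, hb⟩ := this.2 (ModuleCat.ofHom a)
        exact ⟨b.hom, congr(($hb).hom)⟩
  have hp : ∀ M : RightMod R, ∃ (κ : Cardinal.{u}) (_ : Fact κ.IsRegular),
      IsCardinalPresentable M κ := fun M =>
    (inferInstance : IsPresentable.{u} M).exists_cardinal
  choose κ hκ hM using hp
  let c : Cardinal.{u} := max (max Cardinal.aleph0 (κ (ModuleCat.of Rᵐᵒᵖ R)))
    (⨆ I : G.ideals, κ (ModuleCat.of Rᵐᵒᵖ I.1))
  have : Fact (Order.succ c).IsRegular :=
    ⟨Cardinal.isRegular_succ ((le_max_left _ _).trans (le_max_left _ _))⟩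
  rw [hW]
  refine MorphismProperty.isRightAdjoint_ι_isLocal W (Order.succ c) ?_
  rintro X Y f ⟨I⟩
  refine ⟨@isCardinalPresentable_of_le _ _ _ _ (hκ _) (hM _) _ _ ?_,
    @isCardinalPresentable_of_le _ _ _ _ (hκ _) (hM _) _ _ ?_⟩
  · refine le_trans ?_ (Order.le_succ c)
    exact (le_ciSup (f := fun I : G.ideals => κ (ModuleCat.of Rᵐᵒᵖ I.1))
      Cardinal.bddAbove_of_small I).trans (le_max_right _ _)
  · refine le_trans ?_ (Order.le_succ c)
    exact (le_max_right _ _).trans (le_max_left _ _)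

/-- The left adjoint `ℓ` of the inclusion of the `G`-closed modules. -/
noncomputable def reflector : RightMod R ⥤ G.closed.FullSubcategory :=
  G.closed.ι.leftAdjoint

/-- The adjunction between `ℓ` and the inclusion of the `G`-closed modules. -/
noncomputable def adj : G.reflector ⊣ G.closed.ι :=
  Adjunction.ofIsRightAdjoint G.closed.ι

/-- The localization `Q_G` of `R` at `G`, that is, the reflection of the right module `R` in
the category of `G`-closed modules. -/
def Q : Type u := (G.closed.ι.obj (G.reflector.obj (ModuleCat.of Rᵐᵒᵖ R)) : RightMod R)

noncomputable instance : AddCommGroup G.Q :=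
  inferInstanceAs
    (AddCommGroup (G.closed.ι.obj (G.reflector.obj (ModuleCat.of Rᵐᵒᵖ R)) : RightMod R))

noncomputable instance : Module Rᵐᵒᵖ G.Q :=
  inferInstanceAs
    (Module Rᵐᵒᵖ (G.closed.ι.obj (G.reflector.obj (ModuleCat.of Rᵐᵒᵖ R)) : RightMod R))

/-- The reflection map `R → Q_G`, the unit of the adjunction at `R`. -/
noncomputable def unit : R →ₗ[Rᵐᵒᵖ] G.Q :=
  (G.adj.unit.app (ModuleCat.of Rᵐᵒᵖ R)).hom

theorem closed_Q : G.closed (ModuleCat.of Rᵐᵒᵖ G.Q) :=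
  (G.reflector.obj (ModuleCat.of Rᵐᵒᵖ R)).property

/-- The universal property of the reflection `R → Q_G`. -/
theorem bijective_comp_unit (C : RightMod R) (hC : G.closed C) :
    Function.Bijective (fun f : G.Q →ₗ[Rᵐᵒᵖ] C => f.comp G.unit) := by
  let e := (ModuleCat.homEquiv (M := ModuleCat.of Rᵐᵒᵖ G.Q) (N := C)).symm.trans
    ((G.closed.fullyFaithfulι.homEquiv
      (X := G.reflector.obj (ModuleCat.of Rᵐᵒᵖ R)) (Y := ⟨C, hC⟩)).symm.trans
    ((G.adj.homEquiv _ _).trans ModuleCat.homEquiv))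
  have he : (fun f : G.Q →ₗ[Rᵐᵒᵖ] C => f.comp G.unit) = e := rfl
  rw [he]
  exact e.bijective

/-- For `x` in a `G`-closed module `C`, there is a unique linear map `Q_G → C` sending the
image of `1` to `x`. -/
theorem existsUnique_hom (C : RightMod R) (hC : G.closed C) (x : C) :
    ∃! f : G.Q →ₗ[Rᵐᵒᵖ] C, f (G.unit 1) = x := by
  have h1 (f : R →ₗ[Rᵐᵒᵖ] C) (r : R) : f r = op r • f 1 := by
    rw [← map_smul]; simp
  let f₀ : R →ₗ[Rᵐᵒᵖ] C :=
    { toFun := fun r => op r • x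
      map_add' := fun r s => by simp [add_smul]
      map_smul' := fun r s => by simp [mul_smul] }
  obtain ⟨f, hf⟩ := (G.bijective_comp_unit C hC).2 f₀
  refine ⟨f, ?_, fun g hg => (G.bijective_comp_unit C hC).1 ?_⟩
  · simpa [f₀] using LinearMap.congr_fun hf (1 : R)
  · refine Eq.trans ?_ hf.symm
    ext
    simpa [f₀] using hg

/-- Left multiplication by `q` on `Q_G`: the unique endomorphism of the right `R`-module `Q_G`
that sends the image of `1` to `q`. -/
noncomputable def mulLeft (q : G.Q) : G.Q →ₗ[Rᵐᵒᵖ] G.Q :=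
  (G.existsUnique_hom _ G.closed_Q q).choose

theorem mulLeft_unit_one (q : G.Q) : G.mulLeft q (G.unit 1) = q :=
  (G.existsUnique_hom _ G.closed_Q q).choose_spec.1

theorem hom_ext_Q {f g : G.Q →ₗ[Rᵐᵒᵖ] G.Q} (h : f (G.unit 1) = g (G.unit 1)) : f = g :=
  (G.existsUnique_hom _ G.closed_Q (g (G.unit 1))).unique h rfl

theorem mulLeft_unit (q : G.Q) (r : R) : G.mulLeft q (G.unit r) = op r • q := by
  have : G.unit r = op r • G.unit 1 := by rw [← map_smul]; simp
  rw [this, map_smul, mulLeft_unit_one]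

/-- The ring structure on `Q_G` induced by the reflection `R → Q_G`. -/
noncomputable instance : Ring G.Q where
  __ := (inferInstance : AddCommGroup G.Q)
  mul p q := G.mulLeft p q
  one := G.unit 1
  mul_assoc p q s := by
    change G.mulLeft (G.mulLeft p q) s = G.mulLeft p (G.mulLeft q s)
    refine LinearMap.congr_fun (G.hom_ext_Q (g := (G.mulLeft p).comp (G.mulLeft q)) ?_) s
    simp [mulLeft_unit_one]
  one_mul q := by
    change G.mulLeft (G.unit 1) q = q
    exact LinearMap.congr_fun (G.hom_ext_Q (g := LinearMap.id) (by simp [mulLeft_unit_one])) q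
  mul_one q := G.mulLeft_unit_one q
  left_distrib p q s := map_add (G.mulLeft p) q s
  right_distrib p q s := by
    change G.mulLeft (p + q) s = G.mulLeft p s + G.mulLeft q s
    exact LinearMap.congr_fun
      (G.hom_ext_Q (g := G.mulLeft p + G.mulLeft q) (by simp [mulLeft_unit_one])) s
  zero_mul q := by
    change G.mulLeft 0 q = 0
    exact LinearMap.congr_fun (G.hom_ext_Q (g := 0) (by simp [mulLeft_unit_one])) q
  mul_zero p := map_zero (G.mulLeft p)

/-- The ring homomorphism `λ_G : R → Q_G`, with the reflection `R → Q_G` as underlying map. -/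
noncomputable def toQ : R →+* G.Q where
  toFun := G.unit
  map_one' := rfl
  map_mul' r s := by
    change _ = G.mulLeft _ _
    rw [mulLeft_unit, ← map_smul]; simp
  map_zero' := map_zero G.unit
  map_add' := map_add G.unit

/-- The right `R`-module structure of `Q_G` is the one induced by `λ_G`. -/
theorem mul_toQ (q : G.Q) (r : R) : q * G.toQ r = op r • q :=
  G.mulLeft_unit q r

/-- A Gabriel topology is perfect if the `G`-closed modules are exactly the right `R`-modules
in the essential image of restriction of scalars along `λ_G : R → Q_G`. -/
def IsPerfect : Prop :=
  (ModuleCat.restrictScalars.{u} (RingHom.op G.toQ)).essImage = G.closed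

/-- The right `R`-module `Q_G ⊕ Q_G/R`, where `Q_G/R` is the quotient of `Q_G` by the image
of `R`. -/
noncomputable def sumQuotient : RightMod R :=
  ModuleCat.of Rᵐᵒᵖ (G.Q × (G.Q ⧸ LinearMap.range G.unit))

end GabrielTopology

/-- The tilting module `T` arises from perfect localization: there is a perfect Gabriel
topology `G` such that `R` embeds in `Q_G` and `Q_G ⊕ Q_G/R` is a tilting module equivalent
to `T`. -/
def RightMod.ArisesFromPerfectLocalization {R : Type u} [Ring R] (T : RightMod R) : Prop :=
  ∃ G : GabrielTopology R, G.IsPerfect ∧ Function.Injective G.toQ ∧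
    RightMod.IsTilting G.sumQuotient ∧
    RightMod.TiltingEquivalent G.sumQuotient T

/-
Giraud subcategories correspond to Gabriel topologies. Reflection in the `G`-closed modules has
kernel the `G`-torsion and `G`-torsion cokernel, and a closed module is saturated in every
torsion-free module containing it; this makes the reflection left exact. Conversely, the right
ideals `I` for which the reflection of `R / I` vanishes form a Gabriel topology whose closed
modules are the given Giraud subcategory.

If `0 → R → T₀ → T₁ → 0` has `Hom(T₁, T₀) = 0`, then `T₀` is the reflection of `R` in the
perpendicular category of `T₁`. If that category is Giraud with Gabriel topology `G`, it follows
that `Q_G ≅ T₀` and `Q_G / R ≅ T₁`. Every `Q_G`-module is a quotient of a direct sum of copies of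
`Q_G` by another such quotient; as `T₁` has projective dimension at most one, such modules are
perpendicular to `T₁`, which is perfectness. Conversely, for `G` perfect and `Q_G ⊕ Q_G / R`
tilting, the closed modules are the perpendicular category of `Q_G / R`, and `Add` of a tilting
module depends only on its tilting class.
-/

namespace RightMod

variable {R : Type u} [Ring R]

section Hom

variable {M : Type*} [AddCommGroup M] [Module Rᵐᵒᵖ M]

variable (R) in
/-- The homomorphism `r ↦ x r` of right modules, the analogue of `LinearMap.toSpanSingleton`. -/
def toSpanSingleton (x : M) : R →ₗ[Rᵐᵒᵖ] M where
  toFun r := op r • x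
  map_add' r s := by simp [add_smul]
  map_smul' r s := by simp [mul_smul]

@[simp]
theorem toSpanSingleton_apply (x : M) (r : R) : toSpanSingleton R x r = op r • x := rfl

theorem hom_apply (f : R →ₗ[Rᵐᵒᵖ] M) (r : R) : f r = op r • f 1 := by
  rw [← map_smul]; simp

end Hom

section Reflection

variable {A : Type*} [AddCommGroup A] [Module Rᵐᵒᵖ A]

/-- A homomorphism `f : A → X` is a reflection of `A` in `P` if `X` lies in `P` and every
homomorphism from `A` to a module in `P` factors uniquely through `f`. -/
structure IsReflection (P : ObjectProperty (RightMod R)) {X : RightMod R} (f : A →ₗ[Rᵐᵒᵖ] X) :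
    Prop where
  mem : P X
  bijective_comp {C : RightMod R} (hC : P C) :
    Function.Bijective (fun g : X →ₗ[Rᵐᵒᵖ] C => g ∘ₗ f)

theorem IsReflection.exists_linearEquiv {P : ObjectProperty (RightMod R)} {X Y : RightMod R}
    {f : A →ₗ[Rᵐᵒᵖ] X} {g : A →ₗ[Rᵐᵒᵖ] Y} (hf : IsReflection P f) (hg : IsReflection P g) :
    ∃ e : X ≃ₗ[Rᵐᵒᵖ] Y, e.toLinearMap ∘ₗ f = g := by
  obtain ⟨a, ha⟩ := (hf.bijective_comp hg.mem).2 g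
  obtain ⟨b, hb⟩ := (hg.bijective_comp hf.mem).2 f
  dsimp only at ha hb
  have hab : a ∘ₗ b = LinearMap.id := (hg.bijective_comp hg.mem).1 <| by
    simp only [LinearMap.comp_assoc, hb, ha, LinearMap.id_comp]
  have hba : b ∘ₗ a = LinearMap.id := (hf.bijective_comp hf.mem).1 <| by
    simp only [LinearMap.comp_assoc, hb, ha, LinearMap.id_comp]
  exact ⟨LinearEquiv.ofLinearMap a b hab hba, ha⟩

variable {P : ObjectProperty (RightMod R)} {l : RightMod R ⥤ P.FullSubcategory} (adj : l ⊣ P.ι)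

/-- The reflection map `M → ℓ M` of a module in a reflective subcategory, as a linear map. -/
def unitHom (M : RightMod R) : M →ₗ[Rᵐᵒᵖ] (l.obj M).obj := (adj.unit.app M).hom

theorem isReflection_unitHom (M : RightMod R) : IsReflection P (unitHom adj M) where
  mem := (l.obj M).property
  bijective_comp {C} hC := by
    let e := (ModuleCat.homEquiv (M := (l.obj M).obj) (N := C)).symm.trans
      ((P.fullyFaithfulι.homEquiv (X := l.obj M) (Y := ⟨C, hC⟩)).symm.trans
      ((adj.homEquiv _ _).trans ModuleCat.homEquiv))
    exact e.bijective

theorem map_unitHom {M N : RightMod R} (f : M ⟶ N) (x : M) :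
    ((l ⋙ P.ι).map f).hom (unitHom adj M x) = unitHom adj N (f.hom x) :=
  congr(($((adj.unit.naturality f).symm)).hom x)

end Reflection

end RightMod

/-! ### Exactness of the reflection in the closed modules -/

namespace GabrielTopology

open RightMod

variable {R : Type u} [Ring R] (G : GabrielTopology R)

section Saturation

variable {M M' : Type*} [AddCommGroup M] [Module Rᵐᵒᵖ M] [AddCommGroup M'] [Module Rᵐᵒᵖ M']

/-- The `G`-saturation of a submodule `N` of `M`: the elements of `M` whose class in `M / N` is
annihilated by a right ideal in `G`. In particular `G.saturation ⊥` is the `G`-torsion submodule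
of `M`. -/
def saturation (N : Submodule Rᵐᵒᵖ M) : Submodule Rᵐᵒᵖ M where
  carrier := {x | ∃ I ∈ G.ideals, ∀ r ∈ I, op r • x ∈ N}
  zero_mem' := by
    obtain ⟨I, hI⟩ := G.nonempty
    exact ⟨I, hI, fun r _ => by simp⟩
  add_mem' := by
    rintro x y ⟨I, hI, hx⟩ ⟨J, hJ, hy⟩
    exact ⟨I ⊓ J, G.inf_mem I hI J hJ, fun r hr => by
      simpa using add_mem (hx r hr.1) (hy r hr.2)⟩
  smul_mem' := by
    rintro s x ⟨I, hI, hx⟩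
    refine ⟨_, G.colon_mem I hI s.unop, fun r hr => ?_⟩
    simpa [smul_smul] using hx (s.unop * r) hr

variable {G}

theorem mem_saturation {N : Submodule Rᵐᵒᵖ M} {x : M} :
    x ∈ G.saturation N ↔ ∃ I ∈ G.ideals, ∀ r ∈ I, op r • x ∈ N :=
  Iff.rfl

theorem saturation_mono {N N' : Submodule Rᵐᵒᵖ M} (h : N ≤ N') :
    G.saturation N ≤ G.saturation N' :=
  fun _ ⟨I, hI, hx⟩ => ⟨I, hI, fun r hr => h (hx r hr)⟩

theorem le_saturation (N : Submodule Rᵐᵒᵖ M) : N ≤ G.saturation N := fun _ hx =>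
  G.nonempty.imp fun _ hI => ⟨hI, fun _ _ => N.smul_mem _ hx⟩

theorem saturation_comap (f : M →ₗ[Rᵐᵒᵖ] M') (N : Submodule Rᵐᵒᵖ M') :
    G.saturation (N.comap f) = (G.saturation N).comap f := by
  ext x
  simp [mem_saturation]

theorem saturation_saturation (N : Submodule Rᵐᵒᵖ M) :
    G.saturation (G.saturation N) = G.saturation N := by
  refine le_antisymm ?_ (le_saturation _)
  rintro x ⟨I, hI, hx⟩
  refine ⟨N.comap (toSpanSingleton R x), G.mem_of_colon_mem _ ⟨I, hI, fun r hr => ?_⟩,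
    fun r hr => hr⟩
  obtain ⟨J, hJ, hxr⟩ := hx r hr
  refine G.mem_of_le J hJ _ fun s hs => ?_
  simpa [rightColon, mul_smul] using hxr s hs

variable (G M) in
/-- A module is `G`-torsion-free if none of its nonzero elements is annihilated by a right ideal
in `G`. -/
def IsTorsionFree : Prop := G.saturation (⊥ : Submodule Rᵐᵒᵖ M) = ⊥

theorem IsTorsionFree.saturation_ker (hM' : G.IsTorsionFree M') (f : M →ₗ[Rᵐᵒᵖ] M') :
    G.saturation (LinearMap.ker f) = LinearMap.ker f := by
  rw [← Submodule.comap_bot, saturation_comap, hM']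

theorem isTorsionFree_quotient_saturation (N : Submodule Rᵐᵒᵖ M) :
    G.IsTorsionFree (M ⧸ G.saturation N) := by
  refine Submodule.comap_injective_of_surjective (G.saturation N).mkQ_surjective ?_
  rw [← saturation_comap, Submodule.comap_bot, Submodule.ker_mkQ, saturation_saturation]

variable {M'' : Type*} [AddCommGroup M''] [Module Rᵐᵒᵖ M'']

theorem range_le_saturation_range_comp {f : M →ₗ[Rᵐᵒᵖ] M'}
    (hf : G.saturation (LinearMap.range f) = ⊤) (g : M' →ₗ[Rᵐᵒᵖ] M'') :
    LinearMap.range g ≤ G.saturation (LinearMap.range (g ∘ₗ f)) := by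
  rw [LinearMap.range_le_iff_comap, eq_top_iff, ← hf, ← saturation_comap, LinearMap.range_comp]
  exact saturation_mono (Submodule.le_comap_map _ _)

theorem IsTorsionFree.hom_ext (hM'' : G.IsTorsionFree M'') {f : M →ₗ[Rᵐᵒᵖ] M'}
    (hf : G.saturation (LinearMap.range f) = ⊤) {a b : M' →ₗ[Rᵐᵒᵖ] M''} (h : a ∘ₗ f = b ∘ₗ f) :
    a = b := by
  have hle := range_le_saturation_range_comp hf (a - b)
  rwa [LinearMap.sub_comp, h, sub_self, LinearMap.range_zero, hM'', le_bot_iff,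
    LinearMap.range_eq_bot, sub_eq_zero] at hle

end Saturation

variable {G} {A B C : RightMod R}

theorem closed_iff : G.closed C ↔ G.IsTorsionFree C ∧
    ∀ I ∈ G.ideals, ∀ h : I →ₗ[Rᵐᵒᵖ] C, ∃ x : C, ∀ r : I, h r = op (r : R) • x := by
  constructor
  · refine fun hC => ⟨eq_bot_iff.2 ?_, fun I hI h => ?_⟩
    · rintro x ⟨I, hI, hx⟩
      have h0 : toSpanSingleton R x = 0 := (hC I hI).1 (LinearMap.ext fun r => hx r r.2)
      simpa using LinearMap.congr_fun h0 (1 : R)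
    · obtain ⟨f, rfl⟩ := (hC I hI).2 h
      exact ⟨f 1, fun r => hom_apply f r⟩
  · refine fun ⟨hC, hext⟩ I hI => ⟨fun f g hfg => ?_, fun h => ?_⟩
    · refine LinearMap.ext_ring_op (sub_eq_zero.1 ?_)
      rw [← Submodule.mem_bot Rᵐᵒᵖ, ← hC]
      refine ⟨I, hI, fun r hr => ?_⟩
      simpa [smul_sub, ← hom_apply, sub_eq_zero] using LinearMap.congr_fun hfg ⟨r, hr⟩
    · obtain ⟨x, hx⟩ := hext I hI h
      exact ⟨toSpanSingleton R x, LinearMap.ext fun r => (hx r).symm⟩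

theorem isTorsionFree_of_closed (hC : G.closed C) : G.IsTorsionFree C :=
  (closed_iff.1 hC).1

theorem saturation_range_of_injective {M : Type*} [AddCommGroup M] [Module Rᵐᵒᵖ M]
    (hC : G.closed C) (hM : G.IsTorsionFree M) {f : C →ₗ[Rᵐᵒᵖ] M} (hf : Function.Injective f) :
    G.saturation (LinearMap.range f) = LinearMap.range f := by
  refine le_antisymm ?_ (le_saturation _)
  rintro y ⟨I, hI, hy⟩
  let h : I →ₗ[Rᵐᵒᵖ] LinearMap.range f :=
    (toSpanSingleton R y ∘ₗ I.subtype).codRestrict _ fun r => hy r r.2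
  let e := LinearEquiv.ofInjective f hf
  obtain ⟨x, hx⟩ := (closed_iff.1 hC).2 I hI (e.symm.toLinearMap ∘ₗ h)
  have hmem : f x - y ∈ G.saturation (⊥ : Submodule Rᵐᵒᵖ M) := by
    refine ⟨I, hI, fun r hr => ?_⟩
    have hr' : h ⟨r, hr⟩ = e (op r • x) := (e.symm_apply_eq).1 (hx ⟨r, hr⟩)
    have : op r • y = f (op r • x) := congrArg Subtype.val hr'
    simp [smul_sub, this]
  rw [hM, Submodule.mem_bot, sub_eq_zero] at hmem
  exact ⟨x, hmem⟩

theorem closed_of_retract_saturation {E : RightMod R} [Injective E] {N : Submodule Rᵐᵒᵖ E}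
    (hN : G.saturation N = N) (hC : G.IsTorsionFree C) (s : C →ₗ[Rᵐᵒᵖ] N) (p : N →ₗ[Rᵐᵒᵖ] C)
    (hps : p ∘ₗ s = LinearMap.id) : G.closed C := by
  refine closed_iff.2 ⟨hC, fun I hI h => ?_⟩
  let i : ModuleCat.of Rᵐᵒᵖ I ⟶ ModuleCat.of Rᵐᵒᵖ R := ModuleCat.ofHom I.subtype
  have : Mono i := (ModuleCat.mono_iff_injective _).2 Subtype.val_injective
  let k : R →ₗ[Rᵐᵒᵖ] E := (Injective.factorThru (ModuleCat.ofHom (N.subtype ∘ₗ s ∘ₗ h)) i).hom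
  have hk (r : I) : op (r : R) • k 1 = s (h r) := by
    rw [← hom_apply]
    exact congr(($(Injective.comp_factorThru (ModuleCat.ofHom (N.subtype ∘ₗ s ∘ₗ h)) i)).hom r)
  have hk1 : k 1 ∈ N := hN ▸ ⟨I, hI, fun r hr => hk ⟨r, hr⟩ ▸ (s _).2⟩
  refine ⟨p ⟨k 1, hk1⟩, fun r => ?_⟩
  rw [← map_smul, show op (r : R) • (⟨k 1, hk1⟩ : N) = s (h r) from Subtype.ext (hk r)]
  exact (LinearMap.congr_fun hps (h r)).symm

-- `C` is the saturation `N` of `A` in an injective module, modulo torsion; extending the embedding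
-- of `A` along the dense map `A → C` gives a section of `N → C`.
theorem exists_injective_closed (hA : G.IsTorsionFree A) :
    ∃ (C : RightMod R) (j : A →ₗ[Rᵐᵒᵖ] C), G.closed C ∧ Function.Injective j := by
  let E := Injective.under A
  let ι : A →ₗ[Rᵐᵒᵖ] E := (Injective.ι A).hom
  have hι : Function.Injective ι := (ModuleCat.mono_iff_injective _).1 (Injective.ι_mono A)
  let N := G.saturation (LinearMap.range ι)
  let ι' : A →ₗ[Rᵐᵒᵖ] N := ι.codRestrict N fun x => le_saturation _ ⟨x, rfl⟩
  let p := (G.saturation (⊥ : Submodule Rᵐᵒᵖ N)).mkQ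
  let C : RightMod R := ModuleCat.of Rᵐᵒᵖ (N ⧸ G.saturation (⊥ : Submodule Rᵐᵒᵖ N))
  let j : A →ₗ[Rᵐᵒᵖ] C := p ∘ₗ ι'
  have hC : G.IsTorsionFree C := isTorsionFree_quotient_saturation _
  have hj : Function.Injective j := by
    rw [← LinearMap.ker_eq_bot, LinearMap.ker_comp, Submodule.ker_mkQ, ← saturation_comap,
      Submodule.comap_bot, LinearMap.ker_codRestrict, LinearMap.ker_eq_bot.2 hι, hA]
  have hdense : G.saturation (LinearMap.range j) = ⊤ := by
    have hι' : G.saturation (LinearMap.range ι') = ⊤ := by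
      rw [LinearMap.range_codRestrict, saturation_comap, Submodule.comap_subtype_self]
    rw [eq_top_iff, ← Submodule.range_mkQ (G.saturation ⊥)]
    exact range_le_saturation_range_comp hι' p
  have : Mono (ModuleCat.ofHom j) := (ModuleCat.mono_iff_injective _).2 hj
  let φ : C →ₗ[Rᵐᵒᵖ] E := (Injective.factorThru (Injective.ι A) (ModuleCat.ofHom j)).hom
  have hφι : φ ∘ₗ j = ι :=
    congr(($(Injective.comp_factorThru (Injective.ι A) (ModuleCat.ofHom j))).hom)
  have hφN (c : C) : φ c ∈ N := by
    have := range_le_saturation_range_comp hdense φ ⟨c, rfl⟩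
    rwa [hφι] at this
  refine ⟨C, j, closed_of_retract_saturation (saturation_saturation _) hC (φ.codRestrict N hφN) p
    (hC.hom_ext hdense (LinearMap.ext fun a => ?_)), hj⟩
  exact congrArg p (Subtype.ext (LinearMap.congr_fun hφι a) : φ.codRestrict N hφN (j a) = ι' a)

section Reflector

variable (G)

theorem ker_unitHom (A : RightMod R) :
    LinearMap.ker (unitHom G.adj A) = G.saturation (⊥ : Submodule Rᵐᵒᵖ A) := by
  apply le_antisymm
  · let p := (G.saturation (⊥ : Submodule Rᵐᵒᵖ A)).mkQ
    obtain ⟨C, j, hC, hj⟩ := exists_injective_closed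
      (A := ModuleCat.of Rᵐᵒᵖ (A ⧸ G.saturation (⊥ : Submodule Rᵐᵒᵖ A)))
      (isTorsionFree_quotient_saturation _)
    obtain ⟨f, hf⟩ := ((isReflection_unitHom G.adj A).bijective_comp hC).2 (j ∘ₗ p)
    have hker : LinearMap.ker (j ∘ₗ p) = G.saturation ⊥ := by
      rw [LinearMap.ker_comp_of_ker_eq_bot _ (LinearMap.ker_eq_bot.2 hj), Submodule.ker_mkQ]
    rw [← hker, ← hf]
    exact LinearMap.ker_le_ker_comp _ _
  · rw [← (isTorsionFree_of_closed (G.reflector.obj A).property).saturation_ker]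
    exact saturation_mono bot_le

theorem saturation_range_unitHom (A : RightMod R) :
    G.saturation (LinearMap.range (unitHom G.adj A)) = ⊤ := by
  let N := G.saturation (LinearMap.range (unitHom G.adj A))
  obtain ⟨C, j, hC, hj⟩ := exists_injective_closed
    (A := ModuleCat.of Rᵐᵒᵖ ((G.reflector.obj A).obj ⧸ N)) (isTorsionFree_quotient_saturation _)
  have h0 : j ∘ₗ N.mkQ = 0 := by
    refine ((isReflection_unitHom G.adj A).bijective_comp hC).1 (LinearMap.ext fun x => ?_)
    have : N.mkQ (unitHom G.adj A x) = 0 :=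
      (Submodule.Quotient.mk_eq_zero _).2 (le_saturation _ ⟨x, rfl⟩)
    simp [this]
  change N = ⊤
  rw [← N.ker_mkQ, ← LinearMap.ker_comp_of_ker_eq_bot N.mkQ (LinearMap.ker_eq_bot.2 hj), h0,
    LinearMap.ker_zero]

theorem injective_map_of_injective {f : A ⟶ B} (hf : Function.Injective f.hom) :
    Function.Injective ((G.reflector ⋙ G.closed.ι).map f).hom := by
  have hA := isTorsionFree_of_closed (G.reflector.obj A).property
  rw [injective_iff_map_eq_zero]
  intro y hy
  rw [← Submodule.mem_bot Rᵐᵒᵖ, ← hA]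
  obtain ⟨I, hI, hIy⟩ : y ∈ G.saturation (LinearMap.range (unitHom G.adj A)) :=
    saturation_range_unitHom G A ▸ Submodule.mem_top
  refine ⟨I, hI, fun r hr => ?_⟩
  obtain ⟨a, ha⟩ := hIy r hr
  have hfa : a ∈ (LinearMap.ker (unitHom G.adj B)).comap f.hom := by
    rw [Submodule.mem_comap, LinearMap.mem_ker, ← map_unitHom, ha, map_smul, hy, smul_zero]
  rw [ker_unitHom, ← saturation_comap, Submodule.comap_bot, LinearMap.ker_eq_bot.2 hf,
    ← ker_unitHom G] at hfa
  rwa [← ha]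

theorem mem_range_map_of_map_eq_zero {f : A ⟶ B} {g : B ⟶ C} (hf : Function.Injective f.hom)
    (hfg : Function.Exact f.hom g.hom) {y : (G.reflector.obj B).obj}
    (hy : ((G.reflector ⋙ G.closed.ι).map g).hom y = 0) :
    y ∈ LinearMap.range ((G.reflector ⋙ G.closed.ι).map f).hom := by
  have hle : ((LinearMap.ker g.hom).map (unitHom G.adj B)) ≤
      LinearMap.range ((G.reflector ⋙ G.closed.ι).map f).hom := by
    rintro _ ⟨b, hb, rfl⟩
    obtain ⟨a, rfl⟩ := (hfg b).1 hb
    exact ⟨unitHom G.adj A a, map_unitHom G.adj f a⟩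
  rw [← saturation_range_of_injective (G.reflector.obj A).property
      (isTorsionFree_of_closed (G.reflector.obj B).property) (injective_map_of_injective G hf),
    ← saturation_saturation]
  obtain ⟨I, hI, hIy⟩ : y ∈ G.saturation (LinearMap.range (unitHom G.adj B)) :=
    saturation_range_unitHom G B ▸ Submodule.mem_top
  refine ⟨I, hI, fun r hr => ?_⟩
  obtain ⟨b, hb⟩ := hIy r hr
  have hgb : g.hom b ∈ LinearMap.ker (unitHom G.adj C) := by
    rw [LinearMap.mem_ker, ← map_unitHom, hb, map_smul, hy, smul_zero]
  rw [ker_unitHom] at hgb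
  obtain ⟨J, hJ, hJb⟩ := hgb
  refine ⟨J, hJ, fun s hs => hle ⟨op s • b, ?_, ?_⟩⟩
  · simpa using hJb s hs
  · rw [map_smul, hb]

theorem isGiraud_closed : IsGiraud G.closed := by
  have : G.reflector.Additive := G.adj.left_adjoint_additive
  have hL : PreservesFiniteLimits (G.reflector ⋙ G.closed.ι) := by
    rw [Functor.preservesFiniteLimits_iff_forall_exact_map_and_mono]
    refine fun S hS => ⟨?_, ?_⟩
    · rw [ShortComplex.moduleCat_exact_iff]
      exact fun y hy => mem_range_map_of_map_eq_zero G hS.moduleCat_injective_f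
        ((ShortComplex.ShortExact.moduleCat_exact_iff_function_exact S).1 hS.exact) hy
    · exact (ModuleCat.mono_iff_injective _).2
        (injective_map_of_injective G hS.moduleCat_injective_f)
  refine ⟨G.reflector, ⟨G.adj⟩, ⟨fun J _ _ => ?_⟩, ?_⟩
  · exact preservesLimitsOfShape_of_reflects_of_preserves G.reflector G.closed.ι
  · have : PreservesColimits G.reflector := G.adj.leftAdjoint_preservesColimits
    infer_instance

end Reflector

end GabrielTopology

/-! ### The Gabriel topology of a Giraud subcategory -/

namespace RightMod

variable {R : Type u} [Ring R] {P : ObjectProperty (RightMod R)}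
  {l : RightMod R ⥤ P.FullSubcategory} (adj : l ⊣ P.ι)

variable (P) in
/-- A right ideal `I` is dense with respect to `P` if `Hom(R / I, X) = 0` for all `X` in `P`, that
is, if no nonzero element of a module in `P` is annihilated by `I`. -/
def IsDense (I : Submodule Rᵐᵒᵖ R) : Prop :=
  ∀ X : RightMod R, P X → ∀ x : X, (∀ r ∈ I, op r • x = 0) → x = 0

theorem unitHom_quotient_eq_zero {I : Submodule Rᵐᵒᵖ R} (hI : IsDense P I) :
    unitHom adj (ModuleCat.of Rᵐᵒᵖ (R ⧸ I)) = 0 := by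
  refine Submodule.linearMap_qext _ (LinearMap.ext_ring_op ?_)
  refine hI _ (l.obj _).property _ fun r hr => ?_
  have : I.mkQ r = 0 := (Submodule.Quotient.mk_eq_zero _).2 hr
  rw [← hom_apply, LinearMap.comp_apply, this, map_zero]

variable [PreservesFiniteLimits l]

theorem preservesFiniteLimits_comp_ι (adj : l ⊣ P.ι) : PreservesFiniteLimits (l ⋙ P.ι) := by
  have : PreservesLimits P.ι := adj.rightAdjoint_preservesLimits
  exact comp_preservesFiniteLimits _ _

theorem hom_eq_zero_of_unitHom_comp_eq_zero {M N X : RightMod R} {i : M →ₗ[Rᵐᵒᵖ] N}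
    (hi : Function.Injective i) (h : unitHom adj N ∘ₗ i = 0) (hX : P X) (f : M →ₗ[Rᵐᵒᵖ] X) :
    f = 0 := by
  have := preservesFiniteLimits_comp_ι adj
  have : Mono (ModuleCat.ofHom i) := (ModuleCat.mono_iff_injective _).2 hi
  have hLi := (ModuleCat.mono_iff_injective ((l ⋙ P.ι).map (ModuleCat.ofHom i))).1 inferInstance
  have hM : unitHom adj M = 0 := LinearMap.ext fun x => hLi <| by
    rw [map_unitHom, LinearMap.zero_apply, map_zero]
    exact LinearMap.congr_fun h x
  obtain ⟨g, rfl⟩ := ((isReflection_unitHom adj M).bijective_comp hX).2 f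
  dsimp only
  rw [hM, LinearMap.comp_zero]

theorem eq_zero_of_unitHom_eq_zero {N X : RightMod R} {n : N} (hn : unitHom adj N n = 0)
    (hX : P X) {x : X} (h : ∀ r : R, op r • n = 0 → op r • x = 0) : x = 0 := by
  let J := LinearMap.ker (toSpanSingleton R n)
  let i : (R ⧸ J) →ₗ[Rᵐᵒᵖ] N := J.liftQ (toSpanSingleton R n) le_rfl
  have hi : Function.Injective i :=
    LinearMap.ker_eq_bot.1 (Submodule.ker_liftQ_eq_bot _ _ _ le_rfl)
  have h0 : unitHom adj N ∘ₗ i = 0 :=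
    Submodule.linearMap_qext _ (LinearMap.ext_ring_op (by simp [i, hn]))
  have hf := hom_eq_zero_of_unitHom_comp_eq_zero (M := ModuleCat.of Rᵐᵒᵖ (R ⧸ J)) adj hi h0 hX
    (J.liftQ (toSpanSingleton R x) h)
  have hx : toSpanSingleton R x 1 = 0 := LinearMap.congr_fun hf (J.mkQ 1)
  simpa using hx

theorem isDense_ker_toSpanSingleton {N : RightMod R} {n : N} (hn : unitHom adj N n = 0) :
    IsDense P (LinearMap.ker (toSpanSingleton R n)) :=
  fun _ hX _ h => eq_zero_of_unitHom_eq_zero adj hn hX h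

include adj in
theorem IsDense.rightColon {I : Submodule Rᵐᵒᵖ R} (hI : IsDense P I) (x : R) :
    IsDense P (rightColon I x) := by
  have := isDense_ker_toSpanSingleton adj
    (LinearMap.congr_fun (unitHom_quotient_eq_zero adj hI) (I.mkQ x))
  convert this using 1
  ext r
  exact (Submodule.Quotient.mk_eq_zero I (x := x * r)).symm

/-- The Gabriel topology of a Giraud subcategory `P`, formed by the right ideals `I` such that the
reflection of `R / I` vanishes. -/
def gabrielTopology : GabrielTopology R where
  ideals := {I | IsDense P I}
  nonempty := ⟨⊤, fun _ _ x hx => by simpa using hx 1 trivial⟩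
  mem_of_le _ hI _ hle X hX x hx := hI X hX x fun r hr => hx r (hle hr)
  inf_mem I hI K hK X hX x hx := hI X hX x fun r hr =>
    hK.rightColon adj r X hX _ fun s hs => by
      have hrs : r * s ∈ I ⊓ K := ⟨I.smul_mem (op s) hr, hs⟩
      simpa [mul_smul] using hx (r * s) hrs
  colon_mem _ hI := hI.rightColon adj
  mem_of_colon_mem _ := fun ⟨_, hI, h⟩ X hX x hx => hI X hX x fun r hr =>
    h r hr X hX _ fun s hs => by simpa [mul_smul] using hx (r * s) hs

include adj in
theorem isIso_map_subtype {I : Submodule Rᵐᵒᵖ R} (hI : IsDense P I) :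
    IsIso ((l ⋙ P.ι).map (ModuleCat.ofHom I.subtype)) := by
  have := adj.left_adjoint_additive
  have hL := preservesFiniteLimits_comp_ι adj
  rw [Functor.preservesFiniteLimits_iff_forall_exact_map_and_mono] at hL
  have hS := ModuleCat.shortComplex_shortExact
    (ShortComplex.mk (ModuleCat.ofHom I.subtype) (ModuleCat.ofHom I.mkQ)
      (ModuleCat.hom_ext (LinearMap.exact_subtype_mkQ I).linearMap_comp_eq_zero))
    (LinearMap.exact_subtype_mkQ I) I.injective_subtype I.mkQ_surjective
  obtain ⟨hexact, hmono⟩ := hL _ hS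
  have hzero : 𝟙 ((l ⋙ P.ι).obj (ModuleCat.of Rᵐᵒᵖ (R ⧸ I))) = 0 := by
    refine ModuleCat.hom_ext (((isReflection_unitHom adj _).bijective_comp (l.obj _).property).1 ?_)
    simp only [unitHom_quotient_eq_zero adj hI, LinearMap.comp_zero]
  have : Epi ((l ⋙ P.ι).map (ModuleCat.ofHom I.subtype)) :=
    hexact.epi_f (((IsZero.iff_id_eq_zero _).2 hzero).eq_of_tgt _ _)
  exact isIso_of_mono_of_epi _

theorem le_closed_gabrielTopology : P ≤ (gabrielTopology adj).closed := by
  refine fun X hX => GabrielTopology.closed_iff.2 ⟨eq_bot_iff.2 ?_, fun I hI h => ?_⟩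
  · rintro x ⟨I, hI, hx⟩
    exact hI X hX x hx
  · have := isIso_map_subtype adj hI
    let e := (asIso ((l ⋙ P.ι).map (ModuleCat.ofHom I.subtype))).toLinearEquiv
    obtain ⟨g, rfl⟩ := ((isReflection_unitHom adj (ModuleCat.of Rᵐᵒᵖ I)).bijective_comp hX).2 h
    refine ⟨g (e.symm (unitHom adj (ModuleCat.of Rᵐᵒᵖ R) (1 : R))), fun r => ?_⟩
    rw [← map_smul, ← map_smul, ← hom_apply]
    refine congrArg g (e.eq_symm_apply.2 ?_)
    exact map_unitHom adj (ModuleCat.ofHom I.subtype) r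

theorem saturation_range_unitHom_eq_top (C : RightMod R) :
    (gabrielTopology adj).saturation (LinearMap.range (unitHom adj C)) = ⊤ := by
  let N := LinearMap.range (unitHom adj C)
  let K := ModuleCat.of Rᵐᵒᵖ ((l.obj C).obj ⧸ N)
  have hK : unitHom adj K = 0 := by
    refine Submodule.linearMap_qext _ ?_
    refine ((isReflection_unitHom adj C).bijective_comp (l.obj K).property).1 ?_
    ext x
    have : N.mkQ (unitHom adj C x) = 0 := (Submodule.Quotient.mk_eq_zero _).2 ⟨x, rfl⟩
    simp [this]
  refine Submodule.eq_top_iff'.2 fun y => ⟨_, isDense_ker_toSpanSingleton (N := K)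
    (n := N.mkQ y) adj (LinearMap.congr_fun hK _), fun r hr => ?_⟩
  exact (Submodule.Quotient.mk_eq_zero _).1 hr

theorem closed_gabrielTopology [P.IsClosedUnderIsomorphisms] :
    (gabrielTopology adj).closed = P := by
  refine le_antisymm (fun C hC => ?_) (le_closed_gabrielTopology adj)
  have hL := le_closed_gabrielTopology adj _ (l.obj C).property
  have hinj : Function.Injective (unitHom adj C) := by
    refine (injective_iff_map_eq_zero _).2 fun x hx => ?_
    rw [← Submodule.mem_bot Rᵐᵒᵖ, ← GabrielTopology.isTorsionFree_of_closed hC]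
    exact ⟨_, isDense_ker_toSpanSingleton adj hx, fun r hr => hr⟩
  have hsurj : Function.Surjective (unitHom adj C) := by
    rw [← LinearMap.range_eq_top, ← saturation_range_unitHom_eq_top adj]
    exact (GabrielTopology.saturation_range_of_injective hC
      (GabrielTopology.isTorsionFree_of_closed hL) hinj).symm
  exact P.prop_of_iso (LinearEquiv.ofBijective _ ⟨hinj, hsurj⟩).toModuleIso.symm
    (l.obj C).property

end RightMod

/-! ### Add-closures and perpendicular categories -/

section ExtVanishing

universe w

open Abelian

variable {C : Type*} [Category* C] [Abelian C] [HasExt.{w} C] {S : ShortComplex C}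

theorem subsingleton_ext_X₃ (hS : S.ShortExact) (X : C) (n : ℕ)
    (h₂ : Subsingleton (Ext.{w} X S.X₂ n)) (h₁ : Subsingleton (Ext.{w} X S.X₁ (n + 1))) :
    Subsingleton (Ext.{w} X S.X₃ n) := by
  refine subsingleton_of_forall_eq 0 fun x => ?_
  obtain ⟨y, rfl⟩ := Ext.covariant_sequence_exact₃ X hS x rfl (h₁.elim _ _)
  rw [h₂.elim y 0, Ext.zero_comp]

theorem subsingleton_ext_X₁ (hS : S.ShortExact) (X : C) (n : ℕ)
    (h₃ : Subsingleton (Ext.{w} X S.X₃ n)) (h₂ : Subsingleton (Ext.{w} X S.X₂ (n + 1))) :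
    Subsingleton (Ext.{w} X S.X₁ (n + 1)) := by
  refine subsingleton_of_forall_eq 0 fun x => ?_
  obtain ⟨y, rfl⟩ := Ext.covariant_sequence_exact₁ X hS x (h₂.elim _ _) rfl
  rw [h₃.elim y 0, Ext.zero_comp]

theorem exists_lift_of_subsingleton_ext (hS : S.ShortExact) (X : C)
    (h₁ : Subsingleton (Ext.{w} X S.X₁ 1)) (a : X ⟶ S.X₃) : ∃ b : X ⟶ S.X₂, b ≫ S.g = a := by
  obtain ⟨y, hy⟩ := Ext.covariant_sequence_exact₃ X hS (Ext.mk₀ a) rfl (h₁.elim _ _)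
  obtain ⟨b, rfl⟩ := (Ext.mk₀_bijective _ _).2 y
  rw [Ext.mk₀_comp_mk₀] at hy
  exact ⟨b, (Ext.mk₀_bijective _ _).1 hy⟩

theorem exists_extension_of_subsingleton_ext (hS : S.ShortExact) (Y : C)
    (h₃ : Subsingleton (Ext.{w} S.X₃ Y 1)) (a : S.X₁ ⟶ Y) : ∃ b : S.X₂ ⟶ Y, S.f ≫ b = a := by
  obtain ⟨y, hy⟩ := Ext.contravariant_sequence_exact₁ hS Y (Ext.mk₀ a) rfl (h₃.elim _ _)
  obtain ⟨b, rfl⟩ := (Ext.mk₀_bijective _ _).2 y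
  rw [Ext.mk₀_comp_mk₀] at hy
  exact ⟨b, (Ext.mk₀_bijective _ _).1 hy⟩

theorem subsingleton_ext_one_X₁_of_exists_lift (hS : S.ShortExact) (X : C)
    (h : ∀ a : X ⟶ S.X₃, ∃ b : X ⟶ S.X₂, b ≫ S.g = a)
    (h₂ : Subsingleton (Ext.{w} X S.X₂ 1)) : Subsingleton (Ext.{w} X S.X₁ 1) := by
  refine subsingleton_of_forall_eq 0 fun x => ?_
  obtain ⟨y, rfl⟩ := Ext.covariant_sequence_exact₁ X hS x (h₂.elim _ _) rfl
  obtain ⟨a, rfl⟩ := (Ext.mk₀_bijective _ _).2 y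
  obtain ⟨b, rfl⟩ := h a
  rw [← Ext.mk₀_comp_mk₀, Ext.comp_assoc_of_second_deg_zero, hS.comp_extClass, Ext.comp_zero]

omit [HasExt.{w} C] in
theorem shortExact_injective_under [EnoughInjectives C] (N : C) :
    (ShortComplex.mk (Injective.ι N) (cokernel.π (Injective.ι N))
      (cokernel.condition _)).ShortExact where
  exact := ShortComplex.exact_cokernel _

theorem subsingleton_ext_of_exists_lift [EnoughInjectives C] {T M : C}
    (h : ∀ {X Y : C} (g : X ⟶ Y), (∀ a : T ⟶ Y, ∃ b : T ⟶ X, b ≫ g = a) →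
      ∀ a : M ⟶ Y, ∃ b : M ⟶ X, b ≫ g = a) (n : ℕ) (N : C)
    (hN : Subsingleton (Ext.{w} T N (n + 1))) : Subsingleton (Ext.{w} M N (n + 1)) := by
  induction n generalizing N with
  | zero =>
    have hS := shortExact_injective_under N
    exact subsingleton_ext_one_X₁_of_exists_lift hS M
      (h _ (exists_lift_of_subsingleton_ext hS T hN)) (Ext.subsingleton_of_injective _ _ _)
  | succ n ih =>
    have hS := shortExact_injective_under N
    have hT := subsingleton_ext_X₃ hS T _ (Ext.subsingleton_of_injective _ _ _) hN
    exact subsingleton_ext_X₁ hS M _ (ih _ hT) (Ext.subsingleton_of_injective _ _ _)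

end ExtVanishing

namespace RightMod

open Abelian

variable {R : Type u} [Ring R] {T T' M N : RightMod R}

section Add

theorem add_iff : Add T M ↔ ∃ (I : Type u) (p : (I →₀ T) →ₗ[Rᵐᵒᵖ] M) (s : M →ₗ[Rᵐᵒᵖ] (I →₀ T)),
    p ∘ₗ s = LinearMap.id := by
  constructor
  · rintro ⟨I, N, ⟨e⟩⟩
    refine ⟨I, LinearMap.fst _ _ _ ∘ₗ e.symm.toLinearMap, e.toLinearMap ∘ₗ LinearMap.inl _ _ _, ?_⟩
    ext x
    simp
  · rintro ⟨I, p, s, hps⟩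
    let e := lequivProdOfRightSplitExact (LinearMap.ker p).injective_subtype
      (LinearMap.ker p).range_subtype hps
    exact ⟨I, ModuleCat.of Rᵐᵒᵖ (LinearMap.ker p), ⟨(LinearEquiv.prodComm Rᵐᵒᵖ _ _).trans e⟩⟩

theorem Add.refl (T : RightMod R) : Add T T :=
  add_iff.2 ⟨PUnit, Finsupp.lapply .unit, Finsupp.lsingle .unit, by ext; simp⟩

theorem Add.of_retract (hM : Add T M) (p : M →ₗ[Rᵐᵒᵖ] N) (s : N →ₗ[Rᵐᵒᵖ] M)
    (hps : p ∘ₗ s = LinearMap.id) : Add T N := by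
  obtain ⟨I, p', s', hps'⟩ := add_iff.1 hM
  refine add_iff.2 ⟨I, p ∘ₗ p', s' ∘ₗ s, ?_⟩
  rw [LinearMap.comp_assoc, ← LinearMap.comp_assoc s, hps', LinearMap.id_comp, hps]

theorem Add.of_linearEquiv (hM : Add T M) (e : M ≃ₗ[Rᵐᵒᵖ] N) : Add T N :=
  hM.of_retract e.toLinearMap e.symm.toLinearMap e.comp_symm

theorem add_prod_left (M N : RightMod R) : Add (ModuleCat.of Rᵐᵒᵖ (M × N)) M :=
  (Add.refl _).of_retract (LinearMap.fst _ _ _) (LinearMap.inl _ _ _) rfl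

theorem add_prod_right (M N : RightMod R) : Add (ModuleCat.of Rᵐᵒᵖ (M × N)) N :=
  (Add.refl _).of_retract (LinearMap.snd _ _ _) (LinearMap.inr _ _ _) rfl

theorem Add.finsupp (hM : Add T M) (J : Type u) : Add T (ModuleCat.of Rᵐᵒᵖ (J →₀ M)) := by
  obtain ⟨I, p, s, hps⟩ := add_iff.1 hM
  let e : (J × I →₀ T) ≃ₗ[Rᵐᵒᵖ] (J →₀ I →₀ T) := Finsupp.curryLinearEquiv Rᵐᵒᵖ
  refine add_iff.2 ⟨J × I, Finsupp.mapRange.linearMap p ∘ₗ e.toLinearMap,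
    e.symm.toLinearMap ∘ₗ Finsupp.mapRange.linearMap s, LinearMap.ext fun x => ?_⟩
  ext j
  simpa using LinearMap.congr_fun hps (x j)

theorem Add.prod (hM : Add T M) (hN : Add T N) : Add T (ModuleCat.of Rᵐᵒᵖ (M × N)) := by
  obtain ⟨I, p, s, hps⟩ := add_iff.1 hM
  obtain ⟨J, q, t, hqt⟩ := add_iff.1 hN
  let e : (I ⊕ J →₀ T) ≃ₗ[Rᵐᵒᵖ] (I →₀ T) × (J →₀ T) := Finsupp.sumFinsuppLEquivProdFinsupp Rᵐᵒᵖ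
  refine add_iff.2 ⟨I ⊕ J, p.prodMap q ∘ₗ e.toLinearMap, e.symm.toLinearMap ∘ₗ s.prodMap t,
    LinearMap.ext fun x => ?_⟩
  simpa using Prod.ext (LinearMap.congr_fun hps x.1) (LinearMap.congr_fun hqt x.2)

theorem Add.exists_lift (hM : Add T M) {X Y : RightMod R} (g : X ⟶ Y)
    (h : ∀ a : T ⟶ Y, ∃ b : T ⟶ X, b ≫ g = a) (a : M ⟶ Y) : ∃ b : M ⟶ X, b ≫ g = a := by
  obtain ⟨I, p, s, hps⟩ := add_iff.1 hM
  choose b hb using fun i : I => h (ModuleCat.ofHom (a.hom ∘ₗ p ∘ₗ Finsupp.lsingle i))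
  let b' : (I →₀ T) →ₗ[Rᵐᵒᵖ] X := Finsupp.lsum ℕ fun i => (b i).hom
  have hb' : g.hom ∘ₗ b' = a.hom ∘ₗ p := by
    ext i x
    simpa [b'] using congr(($(hb i)).hom x)
  refine ⟨ModuleCat.ofHom (b' ∘ₗ s), ModuleCat.hom_ext ?_⟩
  rw [ModuleCat.hom_comp, ModuleCat.hom_ofHom, ← LinearMap.comp_assoc, hb', LinearMap.comp_assoc,
    hps, LinearMap.comp_id]

theorem Add.subsingleton_ext (hM : Add T M) (n : ℕ) (h : Subsingleton (Ext.{u} T N (n + 1))) :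
    Subsingleton (Ext.{u} M N (n + 1)) :=
  subsingleton_ext_of_exists_lift hM.exists_lift n N h

theorem Add.extPerp_le (hM : Add T M) : extPerp T ≤ extPerp M := by
  rintro N hN (_ | i) hi
  · omega
  · exact hM.subsingleton_ext i (hN _ hi)

theorem Add.projDim_le_one (hM : Add T M) (hT : HasProjectiveDimensionLE T 1) :
    HasProjectiveDimensionLE M 1 := by
  refine HasProjectiveDimensionLT.mk fun i hi Y e => ?_
  obtain ⟨i, rfl⟩ : ∃ j, i = j + 1 := ⟨i - 1, by omega⟩
  exact (hM.subsingleton_ext i (HasProjectiveDimensionLT.subsingleton T 2 _ hi Y)).elim _ _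

end Add

section Perp

theorem extPerp_iff (hT : HasProjectiveDimensionLE T 1) :
    extPerp T M ↔ Subsingleton (Ext.{u} T M 1) := by
  refine ⟨fun h => h 1 one_pos, fun h i hi => ?_⟩
  obtain rfl | hi : i = 1 ∨ 2 ≤ i := by omega
  · exact h
  · exact HasProjectiveDimensionLT.subsingleton T 2 i hi M

theorem extPerp_of_surjective (hT : HasProjectiveDimensionLE T 1) (hM : extPerp T M)
    (g : M →ₗ[Rᵐᵒᵖ] N) (hg : Function.Surjective g) : extPerp T N := by
  rw [extPerp_iff hT] at hM ⊢
  exact subsingleton_ext_X₃ (LinearMap.shortExact_shortComplexKer hg) T 1 hM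
    (HasProjectiveDimensionLT.subsingleton T 2 2 le_rfl _)

theorem extPerp_ker (hT : HasProjectiveDimensionLE T 1) (hM : extPerp T M)
    (g : M →ₗ[Rᵐᵒᵖ] N) (hg : Function.Surjective g)
    (h : ∀ a : T →ₗ[Rᵐᵒᵖ] N, ∃ b : T →ₗ[Rᵐᵒᵖ] M, g ∘ₗ b = a) :
    extPerp T (ModuleCat.of Rᵐᵒᵖ (LinearMap.ker g)) := by
  rw [extPerp_iff hT] at hM ⊢
  refine subsingleton_ext_one_X₁_of_exists_lift (LinearMap.shortExact_shortComplexKer hg) T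
    (fun a => ?_) hM
  obtain ⟨b, hb⟩ := h a.hom
  exact ⟨ModuleCat.ofHom b, ModuleCat.hom_ext hb⟩

theorem exists_comp_eq_of_subsingleton_ext_ker (g : M →ₗ[Rᵐᵒᵖ] N) (hg : Function.Surjective g)
    (h : Subsingleton (Ext.{u} T (ModuleCat.of Rᵐᵒᵖ (LinearMap.ker g)) 1)) (a : T →ₗ[Rᵐᵒᵖ] N) :
    ∃ b : T →ₗ[Rᵐᵒᵖ] M, g ∘ₗ b = a := by
  obtain ⟨b, hb⟩ := exists_lift_of_subsingleton_ext (LinearMap.shortExact_shortComplexKer hg) T h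
    (ModuleCat.ofHom a)
  exact ⟨b.hom, congr(($hb).hom)⟩

theorem perpCat_of_surjective (hT : HasProjectiveDimensionLE T 1) (hM : perpCat T M)
    (g : M →ₗ[Rᵐᵒᵖ] N) (hg : Function.Surjective g)
    (hK : extPerp T (ModuleCat.of Rᵐᵒᵖ (LinearMap.ker g))) : perpCat T N := by
  refine ⟨fun a => ?_, extPerp_of_surjective hT hM.2 g hg⟩
  obtain ⟨b, rfl⟩ := exists_comp_eq_of_subsingleton_ext_ker g hg (hK 1 one_pos) a
  rw [hM.1 b, LinearMap.comp_zero]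

instance isClosedUnderIsomorphisms_extPerp : (extPerp T).IsClosedUnderIsomorphisms where
  of_iso e hM i hi :=
    have : Subsingleton ((extFunctorObj T i).obj _) := hM i hi
    ((extFunctorObj T i).mapIso e).symm.addCommGroupIsoToAddEquiv.subsingleton

instance isClosedUnderIsomorphisms_perpCat : (perpCat T).IsClosedUnderIsomorphisms where
  of_iso {M N} e hM := by
    refine ⟨fun f => ?_, (extPerp T).prop_of_iso e hM.2⟩
    have := hM.1 (e.inv.hom ∘ₗ f)
    ext x
    simpa using congr(e.hom.hom ($this x))

end Perp

section Tilting

variable {T₀ T₁ : RightMod R}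

theorem exists_finsupp_surjective {f : R →ₗ[Rᵐᵒᵖ] N}
    (h : Function.Surjective (fun b : N →ₗ[Rᵐᵒᵖ] M => b ∘ₗ f)) :
    ∃ p : (M →₀ N) →ₗ[Rᵐᵒᵖ] M, Function.Surjective p := by
  choose b hb using fun x : M => h (toSpanSingleton R x)
  refine ⟨Finsupp.lsum ℕ b, fun x => ⟨Finsupp.single x (f 1), ?_⟩⟩
  simpa using LinearMap.congr_fun (hb x) (1 : R)

namespace AddCoresolution

variable (c : AddCoresolution T T₀ T₁)

theorem shortExact : (ShortComplex.mk (ModuleCat.ofHom c.f) (ModuleCat.ofHom c.g)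
    (ModuleCat.hom_ext c.exact.linearMap_comp_eq_zero)).ShortExact :=
  ModuleCat.shortComplex_shortExact _ c.exact c.injective c.surjective

theorem surjective_comp (h : Subsingleton (Ext.{u} T₁ M 1)) :
    Function.Surjective (fun b : T₀ →ₗ[Rᵐᵒᵖ] M => b ∘ₗ c.f) := fun a => by
  obtain ⟨b, hb⟩ := exists_extension_of_subsingleton_ext c.shortExact M h (ModuleCat.ofHom a)
  exact ⟨b.hom, congr(($hb).hom)⟩

theorem injective_comp (h : ∀ d : T₁ →ₗ[Rᵐᵒᵖ] M, d = 0) :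
    Function.Injective (fun b : T₀ →ₗ[Rᵐᵒᵖ] M => b ∘ₗ c.f) := fun a b hab => by
  have := c.shortExact.epi_g
  obtain ⟨d, hd⟩ := c.shortExact.exact.desc' (ModuleCat.ofHom (a - b)) <| ModuleCat.hom_ext <| by
    simpa [LinearMap.sub_comp, sub_eq_zero] using hab
  have : d.hom ∘ₗ c.g = a - b := congr(($hd).hom)
  rwa [h d.hom, LinearMap.zero_comp, eq_comm, sub_eq_zero] at this

theorem bijective_comp (hM : perpCat T₁ M) :
    Function.Bijective (fun b : T₀ →ₗ[Rᵐᵒᵖ] M => b ∘ₗ c.f) :=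
  ⟨c.injective_comp hM.1, c.surjective_comp (hM.2 1 one_pos)⟩

end AddCoresolution

/-- The evaluation map `T^(Hom(T, M)) → M`, whose image is the trace of `T` in `M`. -/
noncomputable def evaluation (T M : RightMod R) : ((T →ₗ[Rᵐᵒᵖ] M) →₀ T) →ₗ[Rᵐᵒᵖ] M :=
  Finsupp.lsum ℕ fun a => a

theorem exists_evaluation_comp_eq (a : T →ₗ[Rᵐᵒᵖ] M) :
    ∃ b : T →ₗ[Rᵐᵒᵖ] (T →ₗ[Rᵐᵒᵖ] M) →₀ T, evaluation T M ∘ₗ b = a :=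
  ⟨Finsupp.lsingle a, by ext; simp [evaluation]⟩

theorem AddCoresolution.evaluation_surjective (c : AddCoresolution T T₀ T₁) (hM : extPerp T M) :
    Function.Surjective (evaluation T M) := fun x => by
  obtain ⟨b, hb⟩ := c.surjective_comp (c.mem_add₁.extPerp_le _ hM 1 one_pos) (toSpanSingleton R x)
  obtain ⟨b', hb'⟩ := c.mem_add₀.exists_lift (ModuleCat.ofHom (evaluation T M)) (fun a => by
    obtain ⟨d, hd⟩ := exists_evaluation_comp_eq a.hom
    exact ⟨ModuleCat.ofHom d, ModuleCat.hom_ext hd⟩) (ModuleCat.ofHom b)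
  have hlift : evaluation T M (b'.hom (c.f 1)) = b (c.f 1) := congr(($hb').hom (c.f 1))
  exact ⟨_, hlift.trans (by simpa using LinearMap.congr_fun hb (1 : R))⟩

theorem IsTilting.extPerp_of_add (hT : IsTilting T) (hM : Add T M) : extPerp T M := by
  obtain ⟨I, p, s, hps⟩ := add_iff.1 hM
  exact extPerp_of_surjective hT.projDim_le_one
    ((extPerp_iff hT.projDim_le_one).2 (hT.ext_directSum I)) p
    (LinearMap.surjective_of_comp_eq_id s p hps)

theorem IsTilting.add_of_subsingleton_ext (hT : IsTilting T) (hM : extPerp T M)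
    (h : ∀ N, extPerp T N → Subsingleton (Ext.{u} M N 1)) : Add T M := by
  obtain ⟨T₀, T₁, ⟨c⟩⟩ := hT.coresolution
  have hsurj := c.evaluation_surjective hM
  have hK := extPerp_ker hT.projDim_le_one (hT.extPerp_of_add ((Add.refl T).finsupp _))
    (evaluation T M) hsurj exists_evaluation_comp_eq
  obtain ⟨s, hs⟩ := exists_comp_eq_of_subsingleton_ext_ker (T := M)
    (M := ModuleCat.of Rᵐᵒᵖ ((T →ₗ[Rᵐᵒᵖ] M) →₀ T)) (evaluation T M) hsurj (h _ hK) LinearMap.id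
  exact add_iff.2 ⟨_, evaluation T M, s, hs⟩

theorem TiltingEquivalent.add_of_add (hT : IsTilting T) (hT' : IsTilting T')
    (h : TiltingEquivalent T' T) (hM : Add T' M) : Add T M := by
  refine hT.add_of_subsingleton_ext (h ▸ hT'.extPerp_of_add hM) fun N hN => ?_
  rw [← h] at hN
  exact hM.extPerp_le N hN 1 one_pos

namespace AddCoresolution

theorem extPerp_prod (c : AddCoresolution T T₀ T₁) (hT : IsTilting T) :
    extPerp (ModuleCat.of Rᵐᵒᵖ (T₀ × T₁)) = extPerp T := by
  refine le_antisymm (fun M hM => ?_) (c.mem_add₀.prod c.mem_add₁).extPerp_le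
  obtain ⟨p, hp⟩ := exists_finsupp_surjective
    (c.surjective_comp ((add_prod_right T₀ T₁).extPerp_le M hM 1 one_pos))
  exact extPerp_of_surjective hT.projDim_le_one (hT.extPerp_of_add (c.mem_add₀.finsupp M)) p hp

theorem isTilting_prod (c : AddCoresolution T T₀ T₁) (hT : IsTilting T) :
    IsTilting (ModuleCat.of Rᵐᵒᵖ (T₀ × T₁)) where
  projDim_le_one := (c.mem_add₀.prod c.mem_add₁).projDim_le_one hT.projDim_le_one
  ext_directSum I := by
    have h := hT.extPerp_of_add ((c.mem_add₀.prod c.mem_add₁).finsupp I)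
    rw [← c.extPerp_prod hT] at h
    exact h 1 one_pos
  coresolution := ⟨T₀, T₁, ⟨{ c with
    mem_add₀ := add_prod_left T₀ T₁
    mem_add₁ := add_prod_right T₀ T₁ }⟩⟩

/-- The coresolution `0 → R → X → X / R → 0` given by an embedding of `R` into a module `X`. -/
def ofInjective {X : RightMod R} (f : R →ₗ[Rᵐᵒᵖ] X) (hf : Function.Injective f) (h₀ : Add T X)
    (h₁ : Add T (ModuleCat.of Rᵐᵒᵖ (X ⧸ LinearMap.range f))) :
    AddCoresolution T X (ModuleCat.of Rᵐᵒᵖ (X ⧸ LinearMap.range f)) where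
  f := f
  g := (LinearMap.range f).mkQ
  injective := hf
  exact := f.exact_map_mkQ_range
  surjective := (LinearMap.range f).mkQ_surjective
  mem_add₀ := h₀
  mem_add₁ := h₁

theorem add_quotient_range (c : AddCoresolution T T₀ T₁) {X : RightMod R} (e : T₀ ≃ₗ[Rᵐᵒᵖ] X)
    {f : R →ₗ[Rᵐᵒᵖ] X} (he : e.toLinearMap ∘ₗ c.f = f) :
    Add T (ModuleCat.of Rᵐᵒᵖ (X ⧸ LinearMap.range f)) := by
  have hker : (LinearMap.ker c.g).map e.toLinearMap = LinearMap.range f := by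
    rw [c.exact.linearMap_ker_eq, ← LinearMap.range_comp, he]
  exact c.mem_add₁.of_linearEquiv ((c.g.quotKerEquivOfSurjective c.surjective).symm.trans
    (Submodule.Quotient.equiv _ _ e hker))

end AddCoresolution

theorem IsTilting.perpCat_finsupp (hT : IsTilting T) (h₁ : Add T T₁) (hM : Add T M)
    (h : ∀ f : T₁ →ₗ[Rᵐᵒᵖ] M, f = 0) (J : Type u) :
    perpCat T₁ (ModuleCat.of Rᵐᵒᵖ (J →₀ M)) := by
  refine ⟨fun f => ?_, h₁.extPerp_le _ (hT.extPerp_of_add (hM.finsupp J))⟩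
  ext x j
  exact LinearMap.congr_fun (h (Finsupp.lapply j ∘ₗ f)) x

end Tilting

end RightMod

/-! ### Perfect localization -/

namespace GabrielTopology

open RightMod

variable {R : Type u} [Ring R] (G : GabrielTopology R) {M : RightMod R}

instance isScalarTower_Q : IsScalarTower Rᵐᵒᵖ G.Qᵐᵒᵖ G.Q where
  smul_assoc r s q := by
    change q * (r • s.unop) = r • (q * s.unop)
    rw [← op_unop r, ← mul_toQ, ← mul_toQ, mul_assoc]

theorem smul_eq_op_toQ_mul (r : Rᵐᵒᵖ) (s : G.Qᵐᵒᵖ) : r • s = RingHom.op G.toQ r * s :=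
  unop_injective (G.mul_toQ s.unop r.unop).symm

theorem essImage_iff : (ModuleCat.restrictScalars.{u} (RingHom.op G.toQ)).essImage M ↔
    ∃ _ : Module G.Qᵐᵒᵖ M, IsScalarTower Rᵐᵒᵖ G.Qᵐᵒᵖ M := by
  constructor
  · rintro ⟨N, ⟨i⟩⟩
    let e : M ≃+ N := i.toLinearEquiv.symm.toAddEquiv
    have he (r : Rᵐᵒᵖ) (x : M) : e (r • x) = RingHom.op G.toQ r • e x :=
      map_smul i.toLinearEquiv.symm r x
    let := e.module G.Qᵐᵒᵖ
    refine ⟨this, ⟨fun r s x => e.injective ?_⟩⟩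
    change e (e.symm ((r • s) • e x)) = e (r • e.symm (s • e x))
    rw [he, e.apply_symm_apply, e.apply_symm_apply, smul_eq_op_toQ_mul, mul_smul]
  · rintro ⟨_, _⟩
    have h (r : Rᵐᵒᵖ) (x : M) : RingHom.op G.toQ r • x = r • x := by
      rw [← smul_one_smul G.Qᵐᵒᵖ r x, smul_eq_op_toQ_mul, mul_one]
    let e : (ModuleCat.restrictScalars.{u} (RingHom.op G.toQ)).obj (ModuleCat.of G.Qᵐᵒᵖ M)
        ≃ₗ[Rᵐᵒᵖ] M :=
      { AddEquiv.refl M with map_smul' := h }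
    exact ⟨ModuleCat.of G.Qᵐᵒᵖ M, ⟨e.toModuleIso⟩⟩

theorem isReflection_unit : IsReflection G.closed (X := ModuleCat.of Rᵐᵒᵖ G.Q) G.unit :=
  isReflection_unitHom G.adj _

variable {G}

theorem essImage_of_bijective (h : Function.Bijective (fun f : G.Q →ₗ[Rᵐᵒᵖ] M => f ∘ₗ G.unit)) :
    (ModuleCat.restrictScalars.{u} (RingHom.op G.toQ)).essImage M := by
  have hext {f g : G.Q →ₗ[Rᵐᵒᵖ] M} (hfg : f 1 = g 1) : f = g := h.1 (LinearMap.ext_ring_op hfg)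
  have hex (x : M) : ∃ f : G.Q →ₗ[Rᵐᵒᵖ] M, f 1 = x :=
    (h.2 (toSpanSingleton R x)).imp fun f hf => (LinearMap.congr_fun hf (1 : R)).trans (by simp)
  choose F hF using hex
  let : Module G.Qᵐᵒᵖ M :=
    { smul := fun q x => F x q.unop
      one_smul := hF
      mul_smul := fun p q x => by
        change F x (q.unop * p.unop) = F (F x q.unop) p.unop
        refine LinearMap.congr_fun (f := F x ∘ₗ G.mulLeft q.unop) (hext ?_) p.unop
        rw [hF]
        exact congrArg (F x) (mul_one q.unop)
      smul_zero := fun q => LinearMap.congr_fun (g := 0) (hext (hF 0)) q.unop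
      smul_add := fun q x y => LinearMap.congr_fun (g := F x + F y)
        (hext (by simp [hF])) q.unop
      add_smul := fun p q x => map_add (F x) p.unop q.unop
      zero_smul := fun x => map_zero (F x) }
  exact G.essImage_iff.2 ⟨this, ⟨fun r s x => map_smul (F x) r s.unop⟩⟩

theorem exists_surjective_of_essImage
    (hM : (ModuleCat.restrictScalars.{u} (RingHom.op G.toQ)).essImage M) :
    ∃ p : (M →₀ G.Q) →ₗ[Rᵐᵒᵖ] M, Function.Surjective p ∧
      (ModuleCat.restrictScalars.{u} (RingHom.op G.toQ)).essImage
        (ModuleCat.of Rᵐᵒᵖ (LinearMap.ker p)) := by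
  obtain ⟨_, _⟩ := G.essImage_iff.1 hM
  let p : (M →₀ G.Q) →ₗ[G.Qᵐᵒᵖ] M := Finsupp.lsum ℕ (toSpanSingleton G.Q)
  refine ⟨p.restrictScalars Rᵐᵒᵖ, fun x => ⟨Finsupp.single x 1, by simp [p]⟩, ?_⟩
  rw [essImage_iff, LinearMap.ker_restrictScalars]
  exact ⟨inferInstanceAs (Module G.Qᵐᵒᵖ (LinearMap.ker p)), inferInstance⟩

end GabrielTopology

namespace GabrielTopology

open RightMod

variable {R : Type u} [Ring R] {G : GabrielTopology R}

theorem isPerfect_of_closed_eq_perpCat {T₁ : RightMod R} (hT₁ : HasProjectiveDimensionLE T₁ 1)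
    (hG : G.closed = perpCat T₁)
    (hQ : ∀ J : Type u, perpCat T₁ (ModuleCat.of Rᵐᵒᵖ (J →₀ G.Q))) : G.IsPerfect := by
  refine le_antisymm (fun M hM => ?_)
    fun M hM => essImage_of_bijective (G.isReflection_unit.bijective_comp hM)
  obtain ⟨p, hp, hK⟩ := exists_surjective_of_essImage hM
  obtain ⟨q, hq, -⟩ := exists_surjective_of_essImage hK
  rw [hG]
  exact perpCat_of_surjective hT₁ (hQ M) p hp (extPerp_of_surjective hT₁ (hQ _).2 q hq)

variable (G) in
/-- The quotient `Q_G / R` as a right `R`-module. -/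
noncomputable abbrev quotient : RightMod R := ModuleCat.of Rᵐᵒᵖ (G.Q ⧸ LinearMap.range G.unit)

theorem hom_quotient_eq_zero {C : RightMod R} (hC : G.closed C) (f : G.quotient →ₗ[Rᵐᵒᵖ] C) :
    f = 0 := by
  refine Submodule.linearMap_qext _ ((G.isReflection_unit.bijective_comp hC).1 ?_)
  change (f ∘ₗ (LinearMap.range G.unit).mkQ) ∘ₗ G.unit = 0 ∘ₗ G.unit
  rw [LinearMap.comp_assoc, LinearMap.range_mkQ_comp, LinearMap.comp_zero, LinearMap.zero_comp]

variable (G) in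
/-- The coresolution `0 → R → Q_G → Q_G / R → 0`. -/
noncomputable def coresolution (h : Function.Injective G.unit) :
    AddCoresolution G.sumQuotient (ModuleCat.of Rᵐᵒᵖ G.Q) G.quotient :=
  .ofInjective G.unit h (add_prod_left (ModuleCat.of Rᵐᵒᵖ G.Q) G.quotient)
    (add_prod_right (ModuleCat.of Rᵐᵒᵖ G.Q) G.quotient)

theorem closed_eq_perpCat (hG : G.IsPerfect) (h : Function.Injective G.unit)
    (hT : IsTilting G.sumQuotient) : G.closed = perpCat G.quotient := by
  let c := G.coresolution h
  refine le_antisymm (fun M hM => ?_) fun M hM => ?_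
  · obtain ⟨p, hp⟩ := exists_finsupp_surjective (G.isReflection_unit.bijective_comp hM).2
    exact ⟨hom_quotient_eq_zero hM, c.mem_add₁.extPerp_le _
      (extPerp_of_surjective hT.projDim_le_one (hT.extPerp_of_add (c.mem_add₀.finsupp M)) p hp)⟩
  · rw [← hG]
    exact essImage_of_bijective (c.bijective_comp hM)

end GabrielTopology

namespace RightMod

variable {R : Type u} [Ring R] {T T₀ T₁ : RightMod R}

theorem AddCoresolution.isReflection (c : AddCoresolution T T₀ T₁) (hT : IsTilting T)
    (h₀ : ∀ f : T₁ →ₗ[Rᵐᵒᵖ] T₀, f = 0) : IsReflection (perpCat T₁) c.f :=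
  ⟨⟨h₀, c.mem_add₁.extPerp_le _ (hT.extPerp_of_add c.mem_add₀)⟩, c.bijective_comp⟩

theorem arisesFromPerfectLocalization_of_isGiraud (hT : IsTilting T)
    (c : AddCoresolution T T₀ T₁) (h₀ : ∀ f : T₁ →ₗ[Rᵐᵒᵖ] T₀, f = 0)
    (hG : IsGiraud (perpCat T₁)) : T.ArisesFromPerfectLocalization := by
  obtain ⟨l, ⟨adj⟩, _, _⟩ := hG
  let G := gabrielTopology adj
  have hG : G.closed = perpCat T₁ := closed_gabrielTopology adj
  obtain ⟨e, he⟩ := (c.isReflection hT h₀).exists_linearEquiv (hG ▸ G.isReflection_unit)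
  have hinj : Function.Injective G.unit := by
    rw [← he]
    exact e.injective.comp c.injective
  have hQ : Add T (ModuleCat.of Rᵐᵒᵖ G.Q) := c.mem_add₀.of_linearEquiv e
  have hQ₁ : ∀ f : T₁ →ₗ[Rᵐᵒᵖ] G.Q, f = 0 := (hG ▸ G.closed_Q : perpCat T₁ _).1
  let c' := AddCoresolution.ofInjective G.unit hinj hQ (c.add_quotient_range e he)
  exact ⟨G, GabrielTopology.isPerfect_of_closed_eq_perpCat
      (c.mem_add₁.projDim_le_one hT.projDim_le_one) hG (hT.perpCat_finsupp c.mem_add₁ hQ hQ₁),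
    hinj, c'.isTilting_prod hT, c'.extPerp_prod hT⟩

theorem ArisesFromPerfectLocalization.exists_isGiraud (hT : IsTilting T)
    (h : T.ArisesFromPerfectLocalization) :
    ∃ T₀ T₁ : RightMod R, Nonempty (AddCoresolution T T₀ T₁) ∧
      (∀ f : T₁ →ₗ[Rᵐᵒᵖ] T₀, f = 0) ∧ IsGiraud (perpCat T₁) := by
  obtain ⟨G, hperf, hinj, hT', heq⟩ := h
  let c := G.coresolution hinj
  refine ⟨_, G.quotient, ⟨{ c with
    mem_add₀ := heq.add_of_add hT hT' c.mem_add₀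
    mem_add₁ := heq.add_of_add hT hT' c.mem_add₁ }⟩,
    GabrielTopology.hom_quotient_eq_zero G.closed_Q, ?_⟩
  rw [← GabrielTopology.closed_eq_perpCat hperf hinj hT']
  exact G.isGiraud_closed

end RightMod

theorem theorem3p6 {R : Type u} [Ring R] (T : RightMod R) (hT : RightMod.IsTilting T) :
    (∃ T₀ T₁ : RightMod R, Nonempty (RightMod.AddCoresolution T T₀ T₁) ∧
      (∀ f : T₁ →ₗ[Rᵐᵒᵖ] T₀, f = 0) ∧ RightMod.IsGiraud (RightMod.perpCat T₁)) ↔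
    RightMod.ArisesFromPerfectLocalization T :=
  ⟨fun ⟨_, _, ⟨c⟩, h₀, hG⟩ => RightMod.arisesFromPerfectLocalization_of_isGiraud hT c h₀ hG,
    fun h => h.exists_isGiraud hT⟩
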